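/- Consider diagrams in the plane of balanced-oriented knotted 4-valent graphs with rigid vertices: each edge is oriented, and at each vertex two edges come in and two go out, so that the cyclic type of a vertex is In-In-Out-Out (IIOO) or In-Out-In-Out (IOIO); components that are circles without vertices are allowed. Diagrams are taken up to planar isotopy. The oriented Reidemeister-type moves are all oriented versions (36 up to planar isotopy) of the following moves: - $\Omega1$ (4 moves): remove a curl from a strand; - $\Omega2$ (4 moves): separate two strands, one of which passes over the other at two consecutive crossings; - $\Omega3$ (8 moves): move a strand over or under a crossing of two other strands, or between these; - $\Omega4$ (8 moves for IIOO vertices, 4 moves for IOIO vertices): move a strand over or under a vertex, from one pair of adjacent edges to the opposite pair; - $\Omega5$ (6 moves for IIOO vertices, 2 moves for IOIO vertices): trade a crossing of two adjacent edges at a vertex for a crossing, with the same handedness of the half-twist, of the other two edges, the vertex being flipped over. Among them are: - $\Omega1a$, $\Omega1b$: a curl with a positive crossing, running clockwise in $\Omega1a$ and counterclockwise in $\Omega1b$; - $\Omega2a$: two parallel strands of which, seen along their common direction, the left one passes over the right one; - $\Omega3a$: the triangle is cyclically oriented, the crossing of the highest and the lowest strand is negative, and the other two crossings are positive; - $\Omega4a$,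 $\Omega4e$: a strand passes over (in $\Omega4a$) or under (in $\Omega4e$) an IIOO vertex, crossing one outgoing and one incoming edge on either side of the move, and the triangle formed by the strand and these two edges is cyclically oriented; - $\Omega5a$: a positive crossing of the two incoming edges of an IIOO vertex is traded for a positive crossing of the two outgoing edges; - $\Omega4j$, $\Omega4l$: a strand passes under (in $\Omega4j$) or over (in $\Omega4l$) an IOIO vertex; on the side of the move on which the triangle formed by the strand and two edges is cyclically oriented, it is oriented counterclockwise; - $\Omega5g$: a negative crossing of two adjacent edges at an IOIO vertex is traded for a negative crossing of the other two edges. A set $S$ of oriented Reidemeister-type moves is called generating if, whenever a diagram $D'$ arises from a diagram $D$ by one of the oriented Reidemeister-type moves, $D$ and $D'$ are joined by a finite sequence of planar isotopies and of moves in $S$, each applied in either direction. Theorem. The set $\{\Omega1a,\Omega1b,\Omega2a,\Omega3a,\Omega4a,\Omega4e,\Omega5a,\Omega4j,\Omega4l,\Omega5g\}$ is a minimal generating set of the oriented Reidemeister-type moves: it is generating, and no proper subset of it is generating. -/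

import Mathlib

/-!
Diagrams of balanced-oriented knotted 4-valent graphs with rigid vertices, up to planar isotopy.

Diagrams are written in Morse position with respect to the height function of the plane: a diagram
is cut by horizontal lines into slices, and each slice holds one local maximum, local minimum,
crossing or vertex, next to vertical strands. A horizontal line at a regular level meets the
diagram in a finite row of oriented strands, recorded as a `List Bool` from left to right, where
`true` means that the strand is directed upward and `false` that it is directed downward.
-/

namespace KnottedGraph

/-- The elementary pieces of an oriented diagram. Crossings and vertices are drawn with two legs
below (south-west, south-east) and two legs above (north-west, north-east). -/
inductive Piece : Type
  /-- A local minimum; its left end has direction `a`, its right end the opposite one. -/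
  | cup (a : Bool)
  /-- A local maximum; its left end has direction `a`, its right end the opposite one. -/
  | cap (a : Bool)
  /-- A crossing of a strand SW-NE of direction `a` with a strand SE-NW of direction `b`.
  The strand SW-NE is the over-strand if `o = true`, and the under-strand if `o = false`. Thus
  the crossing is positive if and only if `o = (a == b)`. -/
  | crossing (o a b : Bool)
  /-- A vertex of type In-In-Out-Out: of two opposite edges, one comes in and one goes out. The
  edges SW and NE have direction `a`, the edges SE and NW have direction `b`. -/
  | vertexIIOO (a b : Bool)
  /-- A vertex of type In-Out-In-Out: opposite edges both come in or both go out. The edges SW and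
  NW have direction `a`, the edges SE and NE have the opposite direction. -/
  | vertexAlternating (a : Bool)

namespace Piece

/-- The strands at the bottom of a piece, from left to right. -/
def source : Piece → List Bool
  | cup _ => []
  | cap a => [a, !a]
  | crossing _ a b => [a, b]
  | vertexIIOO a b => [a, b]
  | vertexAlternating a => [a, !a]

/-- The strands at the top of a piece, from left to right. -/
def target : Piece → List Bool
  | cup a => [a, !a]
  | cap _ => []
  | crossing _ a b => [b, a]
  | vertexIIOO a b => [b, a]
  | vertexAlternating a => [a, !a]

end Piece

/-- A tangle word: the slices from bottom to top. The slice `(k, g)` consists of the piece `g` with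
`k` vertical strands to its left (and any number of vertical strands to its right). -/
abbrev Word : Type := List (ℕ × Piece)

/-- Add `n` vertical strands to the left of a tangle word. -/
def shift (n : ℕ) (w : Word) : Word := w.map fun x => (n + x.1, x.2)

/-- `IsTangle w s t`: the slices of `w` fit together, directions included, to an oriented tangle
diagram with the row of strands `s` at the bottom and the row `t` at the top. -/
inductive IsTangle : Word → List Bool → List Bool → Prop
  | nil (s : List Bool) : IsTangle [] s s
  | cons (g : Piece) (w : Word) (p q t : List Bool)
      (h : IsTangle w (p ++ g.target ++ q) t) :
      IsTangle ((p.length, g) :: w) (p ++ g.source ++ q) t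

/-- A diagram of a balanced-oriented knotted 4-valent graph in the plane: a tangle diagram without
end points. Circles without crossings and vertices, and the empty diagram, are included. -/
structure Diagram : Type where
  /-- The slices from bottom to top. -/
  word : Word
  closed : IsTangle word [] []

/-- `D'` arises from `D` when a part of `D` that is the tangle `L` (with `n` strands of `D` to its
left) is replaced by the tangle `R`, the rest of the diagram being unchanged. -/
def Replaces (L R : Word) (D D' : Diagram) : Prop :=
  ∃ (n : ℕ) (u v : Word), D.word = u ++ shift n L ++ v ∧ D'.word = u ++ shift n R ++ v

/-- The elementary planar isotopies of diagrams in Morse position. -/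
inductive PlanarRule : Word → Word → Prop
  /-- Two pieces next to each other exchange their heights. -/
  | exchange (g h : Piece) (m : ℕ) :
      PlanarRule [(0, g), (g.target.length + m, h)] [(g.source.length + m, h), (0, g)]
  /-- A local minimum and an adjacent local maximum of a strand cancel. -/
  | zigzagLeft (a : Bool) : PlanarRule [(0, .cup a), (1, .cap (!a))] []
  | zigzagRight (a : Bool) : PlanarRule [(1, .cup a), (0, .cap (!a))] []
  /-- A crossing or vertex below the left leg of a local maximum moves through the maximum to
  its other leg and thereby turns clockwise by a right angle. -/
  | turnCrossing (o a b : Bool) :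
      PlanarRule [(0, .crossing o a b), (1, .cap a)] [(1, .crossing (!o) b (!a)), (0, .cap a)]
  | turnIIOO (a b : Bool) :
      PlanarRule [(0, .vertexIIOO a b), (1, .cap a)] [(1, .vertexIIOO b (!a)), (0, .cap a)]
  | turnAlternating (a : Bool) :
      PlanarRule [(0, .vertexAlternating a), (1, .cap (!a))] [(1, .vertexAlternating (!a)), (0, .cap a)]

/-- The oriented Reidemeister-type moves, one for each move up to planar isotopy (a rotation of the
plane by a half-turn may exchange the two sides of a move): 4 moves `Ω1`, 4 moves `Ω2`, 8 moves
`Ω3`, 8 + 4 moves `Ω4` and 6 + 2 moves `Ω5`. -/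
inductive Move : Type
  /-- A strand of direction `a` with a curl on its right; the crossing is positive if `o = true`
  and negative if `o = false`. -/
  | omega1 (o a : Bool)
  /-- The left strand, of direction `a`, passes over the right strand, of direction `b`. -/
  | omega2 (a b : Bool)
  /-- Three strands, the strands that start at the bottom left, middle and right having the
  directions `a`, up and `b`; their heights decrease from left to right if `o = true` and increase
  from left to right if `o = false`. -/
  | omega3 (o a b : Bool)
  /-- A strand directed from the left to the right passes over (`o = true`) or under (`o = false`)
  the vertex `vertexIIOO a b`. -/
  | omega4IIOO (o a b : Bool)
  /-- A strand directed from the left to the right passes over (`o = true`) or under (`o = false`)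
  the vertex `vertexAlternating a`. -/
  | omega4Alternating (o a : Bool)
  /-- A crossing, positive if `o = true` and negative if `o = false`, of the two incoming edges of
  an In-In-Out-Out vertex is traded for one of the two outgoing edges. -/
  | omega5Parallel (o : Bool)
  /-- A crossing of an incoming and an outgoing edge of an In-In-Out-Out vertex is traded for one
  of the other incoming and the other outgoing edge; the lower ends have directions `a`, `!a`. -/
  | omega5Antiparallel (o a : Bool)
  /-- A crossing, negative if `o = true` and positive if `o = false`, of two adjacent edges of an
  In-Out-In-Out vertex is traded for one of the other two edges. -/
  | omega5Alternating (o : Bool)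

namespace Move

/-- One side of a move. -/
def left : Move → Word
  | omega1 o a => [(1, .cup a), (0, .crossing o a a), (1, .cap a)]
  | omega2 a b => [(0, .crossing true a b), (0, .crossing false b a)]
  | omega3 o a b => [(0, .crossing o a true), (1, .crossing o a b), (0, .crossing o true b)]
  | omega4IIOO o a b => [(0, .crossing o true a), (1, .crossing o true b), (0, .vertexIIOO a b)]
  | omega4Alternating o a => [(0, .crossing o true a), (1, .crossing o true (!a)), (0, .vertexAlternating a)]
  | omega5Parallel o => [(0, .crossing o true true), (0, .vertexIIOO true true)]
  | omega5Antiparallel o a => [(0, .crossing o a (!a)), (0, .vertexIIOO (!a) a)]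
  | omega5Alternating o => [(0, .crossing o true false), (0, .vertexAlternating false)]

/-- The other side of a move. -/
def right : Move → Word
  | omega1 _ _ => []
  | omega2 _ _ => []
  | omega3 o a b => [(1, .crossing o true b), (0, .crossing o a b), (1, .crossing o a true)]
  | omega4IIOO o a b => [(1, .vertexIIOO a b), (0, .crossing o true b), (1, .crossing o true a)]
  | omega4Alternating o a => [(1, .vertexAlternating a), (0, .crossing o true a), (1, .crossing o true (!a))]
  | omega5Parallel o => [(0, .vertexIIOO true true), (0, .crossing o true true)]
  | omega5Antiparallel o a => [(0, .vertexIIOO a (!a)), (0, .crossing o (!a) a)]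
  | omega5Alternating o => [(0, .vertexAlternating true), (0, .crossing o true false)]

/-- Upward strand, positive curl (clockwise). -/
def Ω1a : Move := omega1 true true

/-- Downward strand, positive curl (counterclockwise). -/
def Ω1b : Move := omega1 true false

/-- Two parallel strands; seen along their direction, the left one passes over the right one. -/
def Ω2a : Move := omega2 true true

/-- Cyclically oriented triangle with two positive crossings and one negative crossing, the negative
one being that of the highest and the lowest strand. -/
def Ω3a : Move := omega3 false false false

/-- The strand passes over the vertex, whose two incoming edges lie in front of the strand and whose
two outgoing edges lie behind: the triangle is cyclically oriented on both sides of the move. -/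
def Ω4a : Move := omega4IIOO true false true

/-- The same as `Ω4a`, with the strand passing under the vertex. -/
def Ω4e : Move := omega4IIOO false false true

/-- Parallel strands, positive crossing. -/
def Ω5a : Move := omega5Parallel true

/-- The strand passes under the vertex; where the triangle is cyclically oriented, it is so
counterclockwise. -/
def Ω4j : Move := omega4Alternating false false

/-- The same as `Ω4j`, with the strand passing over the vertex. -/
def Ω4l : Move := omega4Alternating true false

/-- Negative crossing. -/
def Ω5g : Move := omega5Alternating true

end Move

/-- One application of a planar isotopy, or of one of the moves in `S`. -/
def Step (S : Set Move) (D D' : Diagram) : Prop :=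
  (∃ L R : Word, PlanarRule L R ∧ Replaces L R D D') ∨ ∃ m ∈ S, Replaces m.left m.right D D'

/-- `D` and `D'` are joined by a finite sequence of planar isotopies and moves in `S`, each in
either direction. -/
def Joined (S : Set Move) : Diagram → Diagram → Prop := Relation.EqvGen (Step S)

/-- `S` is a generating set of the oriented Reidemeister-type moves: every application of every move
to a diagram is obtained by a finite sequence of applications of moves in `S`. -/
def Generates (S : Set Move) : Prop :=
  ∀ (m : Move) (D D' : Diagram), Replaces m.left m.right D D' → Joined S D D'

end KnottedGraph

/-!
Two tangle diagrams are equivalent if they can be exchanged for each other inside every diagram.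
Bending the ends of a crossing or vertex around turns it by a right angle, so that one instance of a
move yields others: the curls and bigons support each other through triangles, all triangles then
come from one of them, and passing a vertex or trading a crossing at it can be rotated.

For minimality, each of the ten moves has a rule for colouring the strands under which the number of
colourings of a diagram is invariant under planar isotopies and the nine other moves, but differs
between the two sides of the tenth move in some diagram.
-/

namespace KnottedGraph

/-! ### Equivalence of tangle diagrams -/

section

deriving instance DecidableEq for Piece

variable {S : Set Move} {s t s₀ t₀ p q r : List Bool} {g : Piece} {k n : ℕ} {u v w : Word}

theorem isTangle_nil_iff : IsTangle [] s t ↔ s = t :=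
  ⟨fun h => by cases h; rfl, fun h => h ▸ .nil s⟩

theorem isTangle_cons_iff : IsTangle ((k, g) :: w) s t ↔
    ∃ p q, p.length = k ∧ s = p ++ g.source ++ q ∧ IsTangle w (p ++ g.target ++ q) t :=
  ⟨fun h => by cases h with | cons _ _ p q _ h => exact ⟨p, q, rfl, rfl, h⟩,
    by rintro ⟨p, q, rfl, rfl, h⟩; exact .cons g w p q t h⟩

theorem isTangle_append_iff : IsTangle (u ++ v) s t ↔ ∃ r, IsTangle u s r ∧ IsTangle v r t := by
  induction u generalizing s with
  | nil => simp [isTangle_nil_iff]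
  | cons x u ih =>
    obtain ⟨k, g⟩ := x
    simp only [List.cons_append, isTangle_cons_iff, ih]
    grind

theorem isTangle_cons_append_iff :
    IsTangle ((p.length, g) :: w) (p ++ g.source ++ q) t ↔ IsTangle w (p ++ g.target ++ q) t := by
  refine ⟨fun h => ?_, fun h => .cons g w p q t h⟩
  obtain ⟨p', q', hp, e, h⟩ := isTangle_cons_iff.1 h
  rw [List.append_assoc, List.append_assoc] at e
  obtain ⟨rfl, rfl⟩ : p = p' ∧ q = q' := by
    obtain ⟨rfl, hq⟩ := List.append_inj e hp.symm
    exact ⟨rfl, List.append_cancel_left hq⟩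
  exact h

/-- The row of strands at the top of a tangle word with the row `s` at the bottom, if the slices fit
together. It makes the typing of tangle words decidable. -/
def run : List Bool → Word → Option (List Bool)
  | s, [] => some s
  | s, (k, g) :: w =>
    if k ≤ s.length ∧ g.source <+: s.drop k then
      run (s.take k ++ g.target ++ s.drop (k + g.source.length)) w
    else none

theorem isTangle_iff_run : IsTangle w s t ↔ run s w = some t := by
  induction w generalizing s with
  | nil => simp [isTangle_nil_iff, run]
  | cons x w ih =>
    obtain ⟨k, g⟩ := x
    rw [isTangle_cons_iff, run]
    constructor
    · rintro ⟨p, q, rfl, rfl, h⟩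
      simpa [← ih] using h
    · intro h
      split_ifs at h with hk
      obtain ⟨hk, q, hq⟩ := hk
      refine ⟨s.take k, q, by simpa, by rw [List.append_assoc, hq, List.take_append_drop], ?_⟩
      rwa [← List.drop_drop, ← hq, List.drop_left, ← ih] at h

instance : Decidable (IsTangle w s t) := decidable_of_iff _ isTangle_iff_run.symm

theorem IsTangle.top_unique (h : IsTangle w s t) (h' : IsTangle w s r) : t = r :=
  Option.some_injective _ <| (isTangle_iff_run.1 h).symm.trans (isTangle_iff_run.1 h')

theorem IsTangle.append (hu : IsTangle u s r) (hv : IsTangle v r t) : IsTangle (u ++ v) s t :=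
  isTangle_append_iff.2 ⟨r, hu, hv⟩

@[simp] theorem shift_nil : shift n [] = [] := rfl

@[simp] theorem shift_cons : shift n ((k, g) :: w) = (n + k, g) :: shift n w := rfl

@[simp] theorem shift_append : shift n (u ++ v) = shift n u ++ shift n v := List.map_append

@[simp] theorem shift_shift : shift n (shift k w) = shift (n + k) w := by
  simp [shift, Function.comp_def, Nat.add_assoc]

@[simp] theorem shift_zero : shift 0 w = w := by simp [shift]

theorem IsTangle.whisker (h : IsTangle w s t) (p q : List Bool) :
    IsTangle (shift p.length w) (p ++ s ++ q) (p ++ t ++ q) := by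
  induction h with
  | nil s => exact .nil _
  | cons g w p' q' t _ ih =>
    have := IsTangle.cons g (shift p.length w) (p ++ p') (q' ++ q) _ (by simpa using ih)
    simpa using this

theorem le_length_of_isTangle_shift (h : IsTangle (shift n w) s t) (hw : w ≠ []) :
    n ≤ s.length := by
  obtain ⟨⟨k, g⟩, w, rfl⟩ := List.exists_cons_of_ne_nil hw
  obtain ⟨p, q, hp, rfl, -⟩ := isTangle_cons_iff.1 h
  simp only [List.length_append]
  lia

theorem exists_of_isTangle_shift (h : IsTangle (shift n w) s t) (hn : n ≤ s.length) :
    ∃ p x y, p.length = n ∧ s = p ++ x ∧ t = p ++ y ∧ IsTangle w x y := by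
  induction w generalizing s with
  | nil =>
    obtain rfl := isTangle_nil_iff.1 h
    exact ⟨s.take n, s.drop n, s.drop n, by simpa, by simp, by simp, .nil _⟩
  | cons x w ih =>
    obtain ⟨k, g⟩ := x
    rw [shift_cons, isTangle_cons_iff] at h
    obtain ⟨a, b, ha, rfl, h⟩ := h
    obtain ⟨p, x, y, rfl, hx, rfl, hw⟩ := ih h (by simp only [List.length_append]; lia)
    obtain ⟨m, rfl⟩ : p <+: a :=
      List.prefix_of_prefix_length_le (l₃ := p ++ x) ⟨x, rfl⟩ ⟨g.target ++ b, by simp [← hx]⟩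
        (by lia)
    obtain rfl : m ++ g.target ++ b = x := by simpa using hx
    exact ⟨p, m ++ g.source ++ b, y, rfl, by simp, rfl,
      isTangle_cons_iff.2 ⟨m, b, by simpa using ha, rfl, hw⟩⟩

/-- A tangle diagram with the rows of strands `s` at the bottom and `t` at the top. -/
structure Tangle (s t : List Bool) : Type where
  /-- The slices from bottom to top. -/
  word : Word
  /-- The slices fit together. By default this is computed for all values of the directions. -/
  isTangle : IsTangle word s t := by
    clear_aux_decl; first | clear * -; decide +kernel +revert | decide +kernel +revert

/-- Tangle diagrams with the same ends that can be exchanged for each other inside every diagram by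
planar isotopies and moves in `S`. -/
def TangleEq (S : Set Move) (X Y : Tangle s t) : Prop :=
  ∀ (p q : List Bool) (u v : Word), IsTangle u [] (p ++ s ++ q) → IsTangle v (p ++ t ++ q) [] →
    ∀ D D' : Diagram, D.word = u ++ shift p.length X.word ++ v →
      D'.word = u ++ shift p.length Y.word ++ v → Joined S D D'

theorem Diagram.word_injective : Function.Injective word := by
  rintro ⟨_, _⟩ ⟨_, _⟩ rfl; rfl

namespace TangleEq

variable {X Y Z : Tangle s t} {L R : Tangle s₀ t₀}

theorem of_word_eq (h : X.word = Y.word) : TangleEq S X Y := fun _ _ _ _ _ _ D D' hD hD' => by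
  obtain rfl := Diagram.word_injective (hD.trans (h ▸ hD'.symm))
  exact .refl _

theorem refl (X : Tangle s t) : TangleEq S X X := of_word_eq rfl

theorem symm (h : TangleEq S X Y) : TangleEq S Y X :=
  fun p q u v hu hv D D' hD hD' => (h p q u v hu hv D' D hD' hD).symm

theorem trans (h : TangleEq S X Y) (h' : TangleEq S Y Z) : TangleEq S X Z :=
  fun p q u v hu hv D D' hD hD' =>
  let E : Diagram := ⟨_, (hu.append (Y.isTangle.whisker p q)).append hv⟩
  (h p q u v hu hv D E hD rfl).trans _ _ _ (h' p q u v hu hv E D' rfl hD')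

instance : Trans (TangleEq S (s := s) (t := t)) (TangleEq S) (TangleEq S) := ⟨trans⟩

theorem of_planarRule (h : PlanarRule X.word Y.word) : TangleEq S X Y :=
  fun p _ u v _ _ _ _ hD hD' => .rel _ _ (.inl ⟨_, _, h, p.length, u, v, hD, hD'⟩)

theorem context (h : TangleEq S L R) (hu : IsTangle u s (p ++ s₀ ++ q))
    (hv : IsTangle v (p ++ t₀ ++ q) t)
    (hX : X.word = u ++ shift p.length L.word ++ v)
    (hY : Y.word = u ++ shift p.length R.word ++ v) : TangleEq S X Y := by
  intro p' q' u' v' hu' hv' D D' hD hD'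
  refine h (p' ++ p) (q ++ q') (u' ++ shift p'.length u) (shift p'.length v ++ v') ?_ ?_ D D' ?_ ?_
  · simpa using hu'.append (hu.whisker p' q')
  · simpa using (hv.whisker p' q').append hv'
  · simp [hD, hX]
  · simp [hD', hY]

theorem cons {X' Y' : Tangle (p ++ g.target ++ q) t} {X Y : Tangle (p ++ g.source ++ q) t}
    (h : TangleEq S X' Y') (hX : X.word = (p.length, g) :: X'.word)
    (hY : Y.word = (p.length, g) :: Y'.word) : TangleEq S X Y :=
  h.context (p := []) (q := []) (u := [(p.length, g)]) (v := [])
    (by simpa using IsTangle.cons g [] p q _ (.nil _)) (by simpa using IsTangle.nil t)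
    (by simpa using hX) (by simpa using hY)

end TangleEq

/-- Put a slice below a tangle word and lift it over the slices to its right. -/
def lift (k : ℕ) (g : Piece) : Word → Word
  | [] => [(k, g)]
  | (j, h) :: w =>
    if k + g.target.length ≤ j then (j - g.target.length + g.source.length, h) :: lift k g w
    else (k, g) :: (j, h) :: w

/-- The normal form of a tangle word up to exchanges of heights in which pieces on the right are as
low as possible. -/
def settle : Word → Word
  | [] => []
  | (k, g) :: w => lift k g (settle w)

theorem TangleEq.exchange (g h : Piece) {m b : List Bool}
    {X Y : Tangle (p ++ g.source ++ (m ++ h.source ++ b)) t}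
    (hw : IsTangle w (p ++ g.target ++ (m ++ h.target ++ b)) t)
    (hX : X.word = (p.length, g) :: ((p ++ g.target ++ m).length, h) :: w)
    (hY : Y.word = ((p ++ g.source ++ m).length, h) :: (p.length, g) :: w) : TangleEq S X Y := by
  let L : Tangle (g.source ++ m ++ h.source ++ b) (g.target ++ m ++ h.target ++ b) :=
    ⟨[(0, g), (g.target.length + m.length, h)], by
      have h₂ := IsTangle.cons h [] (g.target ++ m) b _ (.nil _)
      simpa using IsTangle.cons g _ [] (m ++ h.source ++ b) _ (by simpa using h₂)⟩
  let R : Tangle (g.source ++ m ++ h.source ++ b) (g.target ++ m ++ h.target ++ b) :=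
    ⟨[(g.source.length + m.length, h), (0, g)], by
      have h₂ := IsTangle.cons g [] [] (m ++ h.target ++ b) _ (.nil _)
      simpa using IsTangle.cons h _ (g.source ++ m) b _ (by simpa using h₂)⟩
  have hLR : TangleEq S L R := .of_planarRule (.exchange g h m.length)
  refine hLR.context (u := []) (v := w) (p := p) (q := []) ?_ ?_ ?_ ?_
  · simpa using IsTangle.nil _
  · simpa using hw
  · simp [hX, L]
  · simp [hY, R]

namespace Tangle

theorem exists_tangleEq_lift (X : Tangle (p ++ g.source ++ q) t)
    (hX : X.word = (p.length, g) :: w) : ∃ Y, Y.word = lift p.length g w ∧ TangleEq S X Y := by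
  induction w generalizing q with
  | nil => exact ⟨X, hX, .refl X⟩
  | cons x w ih =>
    obtain ⟨j, h⟩ := x
    rw [lift]
    split_ifs with hj
    swap
    · exact ⟨X, hX, .refl X⟩
    obtain ⟨a, b, rfl, hrow, hw⟩ :=
      isTangle_cons_iff.1 (isTangle_cons_append_iff.1 (hX ▸ X.isTangle))
    obtain ⟨m, rfl⟩ : p ++ g.target <+: a :=
      List.prefix_of_prefix_length_le (l₃ := a ++ h.source ++ b) ⟨q, hrow⟩
        ⟨h.source ++ b, by simp⟩ (by simpa using hj)
    obtain rfl : q = m ++ h.source ++ b := by simpa using hrow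
    replace hw : IsTangle w (p ++ g.target ++ (m ++ h.target ++ b)) t := by simpa using hw
    obtain ⟨Y, hY, hXY⟩ := ih ⟨(p.length, g) :: w, .cons g w p _ t hw⟩ rfl
    have raised (W : Tangle (p ++ g.source ++ (m ++ h.target ++ b)) t) :
        IsTangle (((p ++ g.source ++ m).length, h) :: W.word)
          (p ++ g.source ++ (m ++ h.source ++ b)) t := by
      simpa using IsTangle.cons h W.word (p ++ g.source ++ m) b t (by simpa using W.isTangle)
    refine ⟨⟨_, raised Y⟩, ?_, (TangleEq.exchange (Y := ⟨_, raised ⟨_, .cons g w p _ t hw⟩⟩)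
      g h hw hX rfl).trans ?_⟩
    · simp only [hY, List.length_append, List.cons.injEq, Prod.mk.injEq, and_true]; lia
    · exact hXY.context (u := [((p ++ g.source ++ m).length, h)]) (p := []) (q := []) (v := [])
        (by simpa using IsTangle.cons h [] (p ++ g.source ++ m) b _ (.nil _))
        (by simpa using IsTangle.nil t) (by simp) (by simp)

theorem exists_tangleEq_settle (X : Tangle s t) : ∃ Y, Y.word = settle X.word ∧ TangleEq S X Y := by
  obtain ⟨w, hw⟩ := X
  induction hw with
  | nil s => exact ⟨⟨[], .nil s⟩, rfl, .refl _⟩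
  | cons g w p q t hw ih =>
    obtain ⟨Y, hY, h⟩ := ih
    obtain ⟨Z, hZ, h'⟩ := exists_tangleEq_lift (S := S)
      ⟨(p.length, g) :: Y.word, .cons g _ p q t Y.isTangle⟩ rfl
    exact ⟨Z, by rw [hZ, hY, settle], (h.cons rfl rfl).trans h'⟩

end Tangle

namespace TangleEq

variable {L R : Tangle s₀ t₀} {X Y : Tangle s t}

theorem of_settle_eq (h : settle X.word = settle Y.word) : TangleEq S X Y := by
  obtain ⟨X', hX, hX'⟩ := X.exists_tangleEq_settle (S := S)
  obtain ⟨Y', hY, hY'⟩ := Y.exists_tangleEq_settle (S := S)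
  exact hX'.trans <| (of_word_eq (by rw [hX, hY, h])).trans hY'.symm

/-- Inside `X`, replace the copy of `L` that begins at the `i`-th slice, to the right of `n`
strands, by `R`. The result may be written with other heights of its pieces. -/
theorem replace (h : TangleEq S L R) (i n : ℕ)
    (hfit : X.word = X.word.take i ++ shift n L.word ++ X.word.drop (i + L.word.length) ∧
        settle Y.word =
          settle (X.word.take i ++ shift n R.word ++ X.word.drop (i + L.word.length)) ∧
        (run s (X.word.take i)).any (fun r => n ≤ r.length && s₀.isPrefixOf (r.drop n)) := by
      clear_aux_decl; first | clear * -; decide +kernel +revert | decide +kernel +revert) :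
    TangleEq S X Y := by
  obtain ⟨hX, hY, hs⟩ := hfit
  have hw := X.isTangle
  rw [hX] at hw
  obtain ⟨r', hw, hv⟩ := isTangle_append_iff.1 hw
  obtain ⟨r, hu, hL⟩ := isTangle_append_iff.1 hw
  obtain ⟨p, q, rfl, rfl⟩ : ∃ p q, p.length = n ∧ r = p ++ s₀ ++ q := by
    simp only [isTangle_iff_run.1 hu, Option.any_some, Bool.and_eq_true, decide_eq_true_eq,
      List.isPrefixOf_iff_prefix] at hs
    obtain ⟨hn, q, hq⟩ := hs
    exact ⟨r.take n, q, by simpa, by rw [List.append_assoc, hq, List.take_append_drop]⟩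
  obtain rfl := hL.top_unique (L.isTangle.whisker p q)
  let Z : Tangle s t := ⟨_, (hu.append (R.isTangle.whisker p q)).append hv⟩
  exact (h.context (Y := Z) hu hv hX rfl).trans (of_settle_eq hY.symm)

end TangleEq

end

/-! ### Derived moves -/

section

notation:50 X "≈[" S "]" Y => TangleEq S X Y

open Piece TangleEq

/-- The pieces with four legs, that is, crossings and vertices. -/
inductive Quad : Type
  | crossing (o a b : Bool)
  | iioo (a b : Bool)
  | alternating (a : Bool)
  deriving DecidableEq, Fintype

namespace Quad

/-- A crossing or vertex as a piece of a tangle word. -/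
def piece : Quad → Piece
  | crossing o a b => .crossing o a b
  | iioo a b => .vertexIIOO a b
  | alternating a => .vertexAlternating a

/-- Direction of the south-west leg. -/
def sw : Quad → Bool
  | crossing _ a _ => a
  | iioo a _ => a
  | alternating a => a

/-- Direction of the south-east leg. -/
def se : Quad → Bool
  | crossing _ _ b => b
  | iioo _ b => b
  | alternating a => !a

/-- Direction of the north-west leg. -/
def nw : Quad → Bool
  | crossing _ _ b => b
  | iioo _ b => b
  | alternating a => a

/-- Direction of the north-east leg. -/
def ne : Quad → Bool
  | crossing _ a _ => a
  | iioo a _ => a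
  | alternating a => !a

/-- Clockwise rotation of the plane by a right angle. -/
def rot : Quad → Quad
  | crossing o a b => crossing (!o) b (!a)
  | iioo a b => iioo b (!a)
  | alternating a => alternating (!a)

/-- Half-turn of space about the vertical axis of the plane. -/
def flip : Quad → Quad
  | crossing o a b => crossing o b a
  | iioo a b => iioo b a
  | alternating a => alternating (!a)

theorem flip_nw (g : Quad) : g.flip.nw = g.ne := by cases g <;> rfl

theorem flip_ne (g : Quad) : g.flip.ne = g.nw := by
  cases g <;> first | rfl | exact Bool.not_not _

end Quad

variable {S : Set Move} {o x a b d d₁ d₂ d₃ o₁₂ o₁₃ o₂₃ : Bool} {g h : Quad}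

theorem zigzag_left (a : Bool) :
    (.mk [(0, cup a), (1, cap (!a))] : Tangle [a] [a]) ≈[S] .mk [] :=
  of_planarRule (.zigzagLeft a)

theorem zigzag_right (a : Bool) :
    (.mk [(1, cup a), (0, cap (!a))] : Tangle [!a] [!a]) ≈[S] .mk [] :=
  of_planarRule (.zigzagRight a)

theorem nested_zigzag (a b : Bool) :
    (.mk [(0, cup (!b)), (1, cup (!a)), (3, cap b), (2, cap a)] : Tangle [!b, !a] [!b, !a])
      ≈[S] .mk [] :=
  calc (.mk [(0, cup (!b)), (1, cup (!a)), (3, cap b), (2, cap a)] : Tangle [!b, !a] [!b, !a])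
    _ ≈[S] .mk [(0, cup (!b)), (1, cap b), (1, cup (!a)), (2, cap a)] :=
      (of_planarRule (.exchange (cup (!a)) (cap b) 0) :
        (.mk [(0, cup (!a)), (2, cap b)] : Tangle [b, !b] [!a, a])
          ≈[S] .mk [(0, cap b), (0, cup (!a))]).replace 1 1
    _ ≈[S] .mk [(1, cup (!a)), (2, cap a)] := (zigzag_left (!b)).replace 0 0
    _ ≈[S] .mk [] := (zigzag_left (!a)).replace 0 1

theorem turn_cap (g : Quad) :
    (.mk [(0, g.piece), (1, cap g.ne)] : Tangle [g.sw, g.se, !g.ne] [g.nw])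
      ≈[S] .mk [(1, g.rot.piece), (0, cap g.sw)] := by
  apply of_planarRule
  cases g with
  | crossing o a b => exact .turnCrossing o a b
  | iioo a b => exact .turnIIOO a b
  | alternating a => exact .turnAlternating a

theorem turn_cup (g : Quad) :
    (.mk [(0, cup (!g.sw)), (1, g.piece)] : Tangle [g.se] [!g.sw, g.nw, g.ne])
      ≈[S] .mk [(1, cup (!g.ne)), (0, g.rot.piece)] :=
  calc (.mk [(0, cup (!g.sw)), (1, g.piece)] : Tangle [g.se] [!g.sw, g.nw, g.ne])
    _ ≈[S] .mk [(0, cup (!g.sw)), (3, cup (!g.ne)), (1, g.piece), (2, cap g.ne)] :=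
      (zigzag_right (!g.ne)).symm.replace 2 2
    _ ≈[S] .mk [(1, cup (!g.ne)), (0, g.rot.piece), (0, cup (!g.sw)), (1, cap g.sw)] :=
      (turn_cap g).replace 2 1
    _ ≈[S] .mk [(1, cup (!g.ne)), (0, g.rot.piece)] := (zigzag_left (!g.sw)).replace 2 0

theorem rot_bend (g : Quad) :
    (.mk [(0, g.rot.piece)] : Tangle [g.rot.sw, g.rot.se] [g.rot.nw, g.rot.ne])
      ≈[S] .mk [(0, cup (!g.sw)), (1, g.piece), (2, cap g.ne)] :=
  calc (.mk [(0, g.rot.piece)] : Tangle [g.rot.sw, g.rot.se] [g.rot.nw, g.rot.ne])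
    _ ≈[S] .mk [(0, cup (!g.sw)), (2, g.rot.piece), (1, cap g.sw)] :=
      (zigzag_left (!g.sw)).symm.replace 1 0
    _ ≈[S] .mk [(0, cup (!g.sw)), (1, g.piece), (2, cap g.ne)] := (turn_cap g).symm.replace 1 1

theorem half_turn (g : Quad) :
    (.mk [(0, g.piece), (1, cap g.ne), (0, cap g.nw)] : Tangle [g.sw, g.se, !g.ne, !g.nw] [])
      ≈[S] .mk [(2, g.rot.rot.piece), (1, cap g.se), (0, cap g.sw)] :=
  calc (.mk [(0, g.piece), (1, cap g.ne), (0, cap g.nw)] : Tangle [g.sw, g.se, !g.ne, !g.nw] [])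
    _ ≈[S] .mk [(1, g.rot.piece), (2, cap g.nw), (0, cap g.sw)] := (turn_cap g).replace 0 0
    _ ≈[S] .mk [(2, g.rot.rot.piece), (1, cap g.se), (0, cap g.sw)] := (turn_cap g.rot).replace 0 1

theorem half_turn_pair (hsw : h.sw = g.nw) (hse : h.se = g.ne) :
    (.mk [(0, h.rot.rot.piece), (0, g.rot.rot.piece)] : Tangle [!h.ne, !h.nw] [!g.se, !g.sw])
      ≈[S] .mk [(0, cup (!g.se)), (1, cup (!g.sw)), (2, g.piece), (2, h.piece), (3, cap h.ne),
        (2, cap h.nw)] :=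
  calc (.mk [(0, h.rot.rot.piece), (0, g.rot.rot.piece)] : Tangle [!h.ne, !h.nw] [!g.se, !g.sw])
    _ ≈[S] .mk [(0, cup (!g.se)), (1, cup (!g.sw)), (4, h.rot.rot.piece), (4, g.rot.rot.piece),
        (3, cap g.se), (2, cap g.sw)] := (nested_zigzag g.sw g.se).symm.replace 2 0
    _ ≈[S] .mk [(0, cup (!g.se)), (1, cup (!g.sw)), (2, g.piece), (4, h.rot.rot.piece),
        (3, cap g.ne), (2, cap g.nw)] := (half_turn g).symm.replace 3 2
    _ ≈[S] .mk [(0, cup (!g.se)), (1, cup (!g.sw)), (2, g.piece), (2, h.piece), (3, cap h.ne),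
        (2, cap h.nw)] := (half_turn h).symm.replace 3 2

/-- A curl on the right of a strand of direction `a` can be removed; its crossing is positive if
and only if `o = true`. -/
def Curl (S : Set Move) (o a : Bool) : Prop :=
  (.mk [(1, cup a), (0, crossing o a a), (1, cap a)] : Tangle [a] [a]) ≈[S] .mk []

/-- A left strand of direction `a` and a right strand of direction `b` that form a bigon can be
separated; the left strand passes over the right one if and only if `o = true`. -/
def Bigon (S : Set Move) (o a b : Bool) : Prop :=
  (.mk [(0, crossing o a b), (0, crossing (!o) b a)] : Tangle [a, b] [a, b]) ≈[S] .mk []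

/-- Three strands of directions `d₁`, `d₂`, `d₃` at the bottom, from left to right, can be moved
across each other; strand `i` passes over strand `j` if and only if `oᵢⱼ = true`. -/
def Triangle (S : Set Move) (d₁ d₂ d₃ o₁₂ o₁₃ o₂₃ : Bool) : Prop :=
  (.mk [(0, crossing o₁₂ d₁ d₂), (1, crossing o₁₃ d₁ d₃), (0, crossing o₂₃ d₂ d₃)] :
      Tangle [d₁, d₂, d₃] [d₃, d₂, d₁])
    ≈[S] .mk [(1, crossing o₂₃ d₂ d₃), (0, crossing o₁₃ d₁ d₃), (1, crossing o₁₂ d₁ d₂)]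

/-- A strand of direction `d` from the bottom left to the top right can be moved over (`o = true`)
or under (`o = false`) the crossing or vertex `g`. -/
def Pass (S : Set Move) (o d : Bool) (g : Quad) : Prop :=
  (.mk [(0, crossing o d g.sw), (1, crossing o d g.se), (0, g.piece)] :
      Tangle [d, g.sw, g.se] [g.nw, g.ne, d])
    ≈[S] .mk [(1, g.piece), (0, crossing o d g.nw), (1, crossing o d g.ne)]

/-- A crossing of the lower legs of `g` can be traded for a crossing of the upper legs, `g` being
flipped over. -/
def Trade (S : Set Move) (o : Bool) (g : Quad) : Prop :=
  (.mk [(0, crossing o g.se g.sw), (0, g.piece)] : Tangle [g.se, g.sw] [g.nw, g.ne])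
    ≈[S] .mk [(0, g.flip.piece), (0, crossing o g.ne g.nw)]

theorem Curl.rotate (hc : Curl S o a) :
    (.mk [(0, cup a), (1, crossing o (!a) (!a)), (0, cap a)] : Tangle [!a] [!a]) ≈[S] .mk [] :=
  calc (.mk [(0, cup a), (1, crossing o (!a) (!a)), (0, cap a)] : Tangle [!a] [!a])
    _ ≈[S] .mk [(1, cup a), (0, crossing (!o) (!a) a), (0, cap a)] :=
      (turn_cup (.crossing o (!a) (!a))).replace 0 0
    _ ≈[S] .mk [(1, cup a), (2, cup a), (0, crossing (!o) (!a) a), (1, cap (!a)), (0, cap a)] :=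
      (zigzag_right a).symm.replace 2 1
    _ ≈[S] .mk [(1, cup a), (2, cup a), (1, crossing o a a), (2, cap a), (0, cap (!a))] :=
      (turn_cap (.crossing (!o) (!a) a)).replace 2 0
    _ ≈[S] .mk [(1, cup a), (0, cap (!a))] := hc.replace 1 1
    _ ≈[S] .mk [] := zigzag_right a

theorem Triangle.rotate (ht : Triangle S d₁ d₂ d₃ o₁₂ o₁₃ o₂₃) :
    Triangle S (!d₃) d₁ d₂ (!o₁₃) (!o₂₃) o₁₂ :=
  calc (.mk [(0, crossing (!o₁₃) (!d₃) d₁), (1, crossing (!o₂₃) (!d₃) d₂),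
      (0, crossing o₁₂ d₁ d₂)] : Tangle [!d₃, d₁, d₂] [d₂, d₁, !d₃])
    _ ≈[S] .mk [(3, cup d₃), (0, crossing (!o₁₃) (!d₃) d₁), (1, crossing (!o₂₃) (!d₃) d₂),
        (2, cap (!d₃)), (0, crossing o₁₂ d₁ d₂)] := (zigzag_right d₃).symm.replace 2 2
    _ ≈[S] .mk [(3, cup d₃), (2, crossing o₂₃ d₂ d₃), (0, crossing (!o₁₃) (!d₃) d₁),
        (1, cap (!d₃)), (0, crossing o₁₂ d₁ d₂)] :=
      (turn_cap (.crossing (!o₂₃) (!d₃) d₂)).replace 2 1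
    _ ≈[S] .mk [(3, cup d₃), (2, crossing o₂₃ d₂ d₃), (1, crossing o₁₃ d₁ d₃),
        (2, crossing o₁₂ d₁ d₂), (0, cap (!d₃))] :=
      (turn_cap (.crossing (!o₁₃) (!d₃) d₁)).replace 2 0
    _ ≈[S] .mk [(3, cup d₃), (1, crossing o₁₂ d₁ d₂), (2, crossing o₁₃ d₁ d₃),
        (1, crossing o₂₃ d₂ d₃), (0, cap (!d₃))] := ht.symm.replace 1 1
    _ ≈[S] .mk [(3, cup d₃), (1, crossing o₁₂ d₁ d₂), (0, crossing (!o₂₃) (!d₃) d₂),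
        (2, crossing o₁₃ d₁ d₃), (1, cap (!d₃))] :=
      (turn_cap (.crossing (!o₂₃) (!d₃) d₂)).symm.replace 3 0
    _ ≈[S] .mk [(1, crossing o₁₂ d₁ d₂), (0, crossing (!o₂₃) (!d₃) d₂),
        (1, crossing (!o₁₃) (!d₃) d₁), (3, cup d₃), (2, cap (!d₃))] :=
      (turn_cap (.crossing (!o₁₃) (!d₃) d₁)).symm.replace 3 1
    _ ≈[S] .mk [(1, crossing o₁₂ d₁ d₂), (0, crossing (!o₂₃) (!d₃) d₂),
        (1, crossing (!o₁₃) (!d₃) d₁)] := (zigzag_right d₃).replace 3 2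

theorem Bigon.half_turn (hb : Bigon S o a b) : Bigon S (!o) (!b) (!a) :=
  calc (.mk [(0, crossing (!o) (!b) (!a)), (0, crossing (!!o) (!a) (!b))] :
      Tangle [!b, !a] [!b, !a])
    _ ≈[S] .mk [(0, cup (!b)), (1, cup (!a)), (2, crossing o a b), (2, crossing (!o) b a),
        (3, cap b), (2, cap a)] :=
      (half_turn_pair (g := .crossing o a b) (h := .crossing (!o) b a) rfl rfl).replace 0 0
    _ ≈[S] .mk [(0, cup (!b)), (1, cup (!a)), (3, cap b), (2, cap a)] := hb.replace 2 2
    _ ≈[S] .mk [] := nested_zigzag a b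

theorem Bigon.antiparallel (hc : Curl S x a) (hb : Bigon S o a a)
    (ht : Triangle S (!a) a (!a) (!o) x o) : Bigon S o a (!a) :=
  calc (.mk [(0, crossing o a (!a)), (0, crossing (!o) (!a) a)] : Tangle [a, !a] [a, !a])
    _ ≈[S] .mk [(0, cup a), (2, crossing o a (!a)), (1, crossing x (!a) (!a)),
        (2, crossing (!o) (!a) a), (0, cap a)] := hc.rotate.symm.replace 1 0
    _ ≈[S] .mk [(0, cup a), (1, crossing (!o) (!a) a), (2, crossing x (!a) (!a)),
        (1, crossing o a (!a)), (0, cap a)] := ht.symm.replace 1 1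
    _ ≈[S] .mk [(1, cup a), (0, crossing o a a), (2, crossing x (!a) (!a)),
        (1, crossing o a (!a)), (0, cap a)] := (turn_cup (.crossing (!o) (!a) a)).replace 0 0
    _ ≈[S] .mk [(1, cup a), (0, crossing o a a), (0, crossing (!o) a a),
        (2, crossing x (!a) (!a)), (1, cap a)] := (turn_cap (.crossing (!o) a a)).symm.replace 3 0
    _ ≈[S] .mk [(1, cup a), (2, crossing x (!a) (!a)), (1, cap a)] := hb.replace 1 0
    _ ≈[S] .mk [] := hc.rotate.replace 0 1

theorem Curl.cap_crossing (hc : Curl S o (!a)) :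
    (.mk [(0, crossing (!o) a (!a)), (0, cap (!a))] : Tangle [a, !a] []) ≈[S] .mk [(0, cap a)] :=
  calc (.mk [(0, crossing (!o) a (!a)), (0, cap (!a))] : Tangle [a, !a] [])
    _ ≈[S] .mk [(0, cup (!a)), (2, crossing (!o) a (!a)), (1, cap a), (0, cap (!a))] :=
      (zigzag_left (!a)).symm.replace 1 0
    _ ≈[S] .mk [(0, cup (!a)), (1, crossing o a a), (0, cap (!a)), (0, cap a)] :=
      (turn_cap (.crossing o a a)).symm.replace 1 1
    _ ≈[S] .mk [(0, cap a)] := hc.rotate.replace 0 0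

theorem Curl.mirror (hc : Curl S o (!a)) (hb : Bigon S o (!a) a) : Curl S (!o) a :=
  calc (.mk [(1, cup a), (0, crossing (!o) a a), (1, cap a)] : Tangle [a] [a])
    _ ≈[S] .mk [(0, cup a), (1, crossing o (!a) a), (1, cap a)] :=
      (turn_cup (.crossing o (!a) a)).symm.replace 0 0
    _ ≈[S] .mk [(0, cup a), (1, crossing o (!a) a), (1, crossing (!o) a (!a)), (1, cap (!a))] :=
      hc.cap_crossing.symm.replace 2 1
    _ ≈[S] .mk [(0, cup a), (1, cap (!a))] := hb.replace 1 1
    _ ≈[S] .mk [] := zigzag_left a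

theorem Bigon.parallel (hc : Curl S o a) (hb : Bigon S o (!a) a)
    (ht : Triangle S a a a o o (!o)) : Bigon S o a a :=
  calc (.mk [(0, crossing o a a), (0, crossing (!o) a a)] : Tangle [a, a] [a, a])
    _ ≈[S] .mk [(2, cup a), (0, crossing o a a), (1, crossing o a a), (0, crossing (!o) a a),
        (2, cap a)] := hc.symm.replace 1 1
    _ ≈[S] .mk [(2, cup a), (1, crossing (!o) a a), (0, crossing o a a), (1, crossing o a a),
        (2, cap a)] := ht.replace 1 0
    _ ≈[S] .mk [(1, cup a), (2, crossing o (!a) a), (0, crossing o a a), (1, crossing o a a),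
        (2, cap a)] := (turn_cup (.crossing o (!a) a)).symm.replace 0 1
    _ ≈[S] .mk [(1, cup a), (0, crossing o a a), (2, crossing o (!a) a),
        (2, crossing (!o) a (!a)), (1, cap a)] := (turn_cap (.crossing o a a)).replace 3 1
    _ ≈[S] .mk [(1, cup a), (0, crossing o a a), (1, cap a)] := hb.replace 2 2
    _ ≈[S] .mk [] := hc.replace 0 0

theorem Triangle.swap (ht : Triangle S d₁ d₂ d₃ o₁₂ o₁₃ o₂₃) (hb : Bigon S o₁₂ d₁ d₂)
    (hb' : Bigon S (!o₁₂) d₂ d₁) : Triangle S d₂ d₁ d₃ (!o₁₂) o₂₃ o₁₃ :=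
  calc (.mk [(0, crossing (!o₁₂) d₂ d₁), (1, crossing o₂₃ d₂ d₃), (0, crossing o₁₃ d₁ d₃)] :
      Tangle [d₂, d₁, d₃] [d₃, d₁, d₂])
    _ ≈[S] .mk [(0, crossing (!o₁₂) d₂ d₁), (1, crossing o₂₃ d₂ d₃), (0, crossing o₁₃ d₁ d₃),
        (1, crossing o₁₂ d₁ d₂), (1, crossing (!o₁₂) d₂ d₁)] := hb.symm.replace 3 1
    _ ≈[S] .mk [(0, crossing (!o₁₂) d₂ d₁), (0, crossing o₁₂ d₁ d₂), (1, crossing o₁₃ d₁ d₃),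
        (0, crossing o₂₃ d₂ d₃), (1, crossing (!o₁₂) d₂ d₁)] := ht.symm.replace 1 0
    _ ≈[S] .mk [(1, crossing o₁₃ d₁ d₃), (0, crossing o₂₃ d₂ d₃),
        (1, crossing (!o₁₂) d₂ d₁)] := hb'.replace 0 0

section AllBigons

variable (hb : ∀ o a b, Bigon S o a b)
include hb

theorem Triangle.swap_right (ht : Triangle S d₁ d₂ d₃ o₁₂ o₁₃ o₂₃) :
    Triangle S d₁ d₃ d₂ o₁₃ o₁₂ (!o₂₃) := by
  simpa using (ht.rotate.rotate.swap (hb _ _ _) (hb _ _ _)).rotate.rotate.rotate.rotate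

theorem Triangle.flip_right (ht : Triangle S d₁ d₂ d₃ o₁₂ o₁₃ o₂₃) :
    Triangle S d₁ d₂ (!d₃) o₁₂ o₁₃ o₂₃ := by
  simpa using (ht.rotate.swap (hb _ _ _) (hb _ _ _)).swap_right hb

theorem Triangle.flip_left (ht : Triangle S d₁ d₂ d₃ o₁₂ o₁₃ o₂₃) :
    Triangle S (!d₁) d₂ d₃ o₁₂ o₁₃ o₂₃ := by
  simpa using (ht.rotate.rotate.flip_right hb).rotate.rotate.rotate.rotate

theorem Triangle.reverse (ht : Triangle S d₁ d₂ d₃ o₁₂ o₁₃ o₂₃) :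
    Triangle S d₃ d₂ d₁ (!o₂₃) (!o₁₃) (!o₁₂) := by
  simpa using ((ht.swap (hb _ _ _) (hb _ _ _)).swap_right hb).swap (hb _ _ _) (hb _ _ _)

theorem Triangle.monotone (ht : Triangle S d₁ true d₃ o o o) (o' a b : Bool) :
    Triangle S a true b o' o' o' := by
  have outer {d₁ d₃} (ht : Triangle S d₁ true d₃ o' o' o') : Triangle S a true b o' o' o' := by
    have ha : Triangle S a true d₃ o' o' o' := by
      obtain rfl | rfl := Bool.eq_or_eq_not a d₁
      exacts [ht, ht.flip_left hb]
    obtain rfl | rfl := Bool.eq_or_eq_not b d₃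
    exacts [ha, ha.flip_right hb]
  obtain rfl | rfl := Bool.eq_or_eq_not o' o
  exacts [outer ht, outer (ht.reverse hb)]

theorem Pass.rotate (hp : Pass S o d g) : Pass S o d g.rot :=
  calc (.mk [(0, crossing o d g.rot.sw), (1, crossing o d g.rot.se), (0, g.rot.piece)] :
      Tangle [d, g.rot.sw, g.rot.se] [g.rot.nw, g.rot.ne, d])
    _ ≈[S] .mk [(0, cup (!g.sw)), (2, crossing o d g.se), (1, g.piece), (3, crossing o d (!g.ne)),
        (2, cap g.ne)] := (rot_bend g).replace 2 0
    _ ≈[S] .mk [(0, cup (!g.sw)), (1, crossing (!o) g.sw d), (1, crossing o d g.sw),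
        (2, crossing o d g.se), (1, g.piece), (3, crossing o d (!g.ne)), (2, cap g.ne)] :=
      (hb (!o) g.sw d).symm.replace 1 1
    _ ≈[S] .mk [(1, cup (!g.sw)), (0, crossing o d (!g.sw)), (1, crossing o d g.sw),
        (2, crossing o d g.se), (1, g.piece), (3, crossing o d (!g.ne)), (2, cap g.ne)] :=
      (turn_cup (.crossing (!o) g.sw d)).replace 0 0
    _ ≈[S] .mk [(1, cup (!g.sw)), (0, crossing o d (!g.sw)), (2, g.piece), (1, crossing o d g.nw),
        (2, crossing o d g.ne), (3, crossing o d (!g.ne)), (2, cap g.ne)] := hp.replace 2 1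
    _ ≈[S] .mk [(1, cup (!g.sw)), (0, crossing o d (!g.sw)), (2, g.piece), (1, crossing o d g.nw),
        (2, crossing o d g.ne), (2, crossing (!o) g.ne d), (3, cap g.ne)] :=
      (turn_cap (.crossing (!o) g.ne d)).symm.replace 5 2
    _ ≈[S] .mk [(1, cup (!g.sw)), (2, g.piece), (3, cap g.ne), (0, crossing o d (!g.sw)),
        (1, crossing o d g.nw)] := (hb o d g.ne).replace 4 2
    _ ≈[S] .mk [(1, g.rot.piece), (0, crossing o d g.rot.nw), (1, crossing o d g.rot.ne)] :=
      (rot_bend g).symm.replace 0 1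

theorem Pass.from_right (hp : Pass S o d g) :
    (.mk [(1, crossing (!o) g.se d), (0, crossing (!o) g.sw d), (1, g.piece)] :
        Tangle [g.sw, g.se, d] [d, g.nw, g.ne])
      ≈[S] .mk [(0, g.piece), (1, crossing (!o) g.ne d), (0, crossing (!o) g.nw d)] :=
  calc (.mk [(1, crossing (!o) g.se d), (0, crossing (!o) g.sw d), (1, g.piece)] :
      Tangle [g.sw, g.se, d] [d, g.nw, g.ne])
    _ ≈[S] .mk [(1, crossing (!o) g.se d), (0, crossing (!o) g.sw d), (1, g.piece),
        (0, crossing o d g.nw), (0, crossing (!o) g.nw d)] := (hb o d g.nw).symm.replace 3 0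
    _ ≈[S] .mk [(1, crossing (!o) g.se d), (0, crossing (!o) g.sw d), (1, g.piece),
        (0, crossing o d g.nw), (1, crossing o d g.ne), (1, crossing (!o) g.ne d),
        (0, crossing (!o) g.nw d)] := (hb o d g.ne).symm.replace 4 1
    _ ≈[S] .mk [(1, crossing (!o) g.se d), (0, crossing (!o) g.sw d), (0, crossing o d g.sw),
        (1, crossing o d g.se), (0, g.piece), (1, crossing (!o) g.ne d),
        (0, crossing (!o) g.nw d)] := hp.symm.replace 2 0
    _ ≈[S] .mk [(1, crossing (!o) g.se d), (1, crossing o d g.se), (0, g.piece),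
        (1, crossing (!o) g.ne d), (0, crossing (!o) g.nw d)] := (hb (!o) g.sw d).replace 1 0
    _ ≈[S] .mk [(0, g.piece), (1, crossing (!o) g.ne d), (0, crossing (!o) g.nw d)] :=
      (hb (!o) g.se d).replace 0 1

theorem Trade.flip (ht : Trade S o g) : Trade S (!o) g.flip :=
  calc (.mk [(0, crossing (!o) g.flip.se g.flip.sw), (0, g.flip.piece)] :
      Tangle [g.flip.se, g.flip.sw] [g.flip.nw, g.flip.ne])
    _ ≈[S] .mk [(0, crossing (!o) g.sw g.se), (0, g.flip.piece), (0, crossing o g.ne g.nw),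
        (0, crossing (!o) g.nw g.ne)] := (hb o g.ne g.nw).symm.replace 2 0
    _ ≈[S] .mk [(0, crossing (!o) g.sw g.se), (0, crossing o g.se g.sw), (0, g.piece),
        (0, crossing (!o) g.nw g.ne)] := ht.symm.replace 1 0
    _ ≈[S] .mk [(0, g.flip.flip.piece), (0, crossing (!o) g.flip.ne g.flip.nw)] :=
      (hb (!o) g.sw g.se).replace 0 0

theorem Trade.rotate (hc : Curl S o g.rot.se) (hc' : Curl S o g.rot.nw)
    (hp : Pass S o g.rot.se g.rot) (hp' : Pass S (!o) g.rot.nw g.rot.flip)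
    (ht : Trade S (!o) g.flip) : Trade S o g.rot :=
  calc (.mk [(0, crossing o g.rot.se g.rot.sw), (0, g.rot.piece)] :
      Tangle [g.rot.se, g.rot.sw] [g.rot.nw, g.rot.ne])
    _ ≈[S] .mk [(2, cup g.rot.se), (0, crossing o g.rot.se g.rot.sw),
        (1, crossing o g.rot.se g.rot.se), (0, g.rot.piece), (2, cap g.rot.se)] :=
      hc.symm.replace 1 1
    _ ≈[S] .mk [(2, cup g.rot.se), (1, g.rot.piece), (0, crossing o g.rot.se g.rot.nw),
        (1, crossing o g.rot.se g.rot.ne), (2, cap g.rot.se)] := hp.replace 1 0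
    _ ≈[S] .mk [(1, cup (!g.sw)), (2, g.piece), (0, crossing o g.rot.se g.rot.nw),
        (1, crossing o g.rot.se g.rot.ne), (2, cap g.rot.se)] := (turn_cup g).symm.replace 0 1
    _ ≈[S] .mk [(1, cup (!g.sw)), (0, crossing o g.rot.se g.rot.nw), (2, g.piece),
        (2, crossing (!o) g.nw g.ne), (1, cap g.rot.se)] :=
      (turn_cap (.crossing o g.rot.se g.rot.ne)).replace 3 1
    _ ≈[S] .mk [(1, cup (!g.sw)), (2, crossing (!o) g.sw g.se), (0, crossing o g.rot.se g.rot.nw),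
        (2, g.flip.piece), (1, cap g.rot.se)] := ht.symm.replace 2 2
    _ ≈[S] .mk [(1, cup (!g.sw)), (2, crossing (!o) g.sw g.se), (0, crossing o g.rot.se g.rot.nw),
        (1, g.rot.flip.piece), (2, cap g.rot.nw)] := (turn_cap g.rot.flip).symm.replace 3 1
    _ ≈[S] .mk [(2, cup (!g.sw)), (1, crossing o g.se g.rot.nw), (0, crossing o g.rot.se g.rot.nw),
        (1, g.rot.flip.piece), (2, cap g.rot.nw)] :=
      (turn_cup (.crossing (!o) g.sw g.se)).replace 0 1
    _ ≈[S] .mk [(0, g.rot.flip.piece), (2, cup g.rot.nw), (1, crossing o g.rot.nw g.rot.nw),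
        (2, cap g.rot.nw), (0, crossing o g.rot.ne g.rot.nw)] := (hp'.from_right hb).replace 1 0
    _ ≈[S] .mk [(0, g.rot.flip.piece), (0, crossing o g.rot.ne g.rot.nw)] := hc'.replace 1 1

end AllBigons

theorem Trade.half_turn (ht : Trade S o g) : Trade S o g.flip.rot.rot :=
  calc (.mk [(0, crossing o g.flip.rot.rot.se g.flip.rot.rot.sw), (0, g.flip.rot.rot.piece)] :
      Tangle [g.flip.rot.rot.se, g.flip.rot.rot.sw] [g.flip.rot.rot.nw, g.flip.rot.rot.ne])
    _ ≈[S] .mk [(0, cup (!g.sw)), (1, cup (!g.se)), (2, g.flip.piece), (2, crossing o g.ne g.nw),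
        (3, cap g.ne), (2, cap g.nw)] :=
      (half_turn_pair (g := g.flip) (h := .crossing o g.ne g.nw) g.flip_nw.symm
        g.flip_ne.symm).replace 0 0
    _ ≈[S] .mk [(0, cup (!g.sw)), (1, cup (!g.se)), (2, crossing o g.se g.sw), (2, g.piece),
        (3, cap g.ne), (2, cap g.nw)] := ht.symm.replace 2 2
    _ ≈[S] .mk [(0, g.flip.rot.rot.flip.piece),
        (0, crossing o g.flip.rot.rot.ne g.flip.rot.rot.nw)] :=
      (half_turn_pair (g := .crossing o g.se g.sw) (h := g) rfl rfl).symm.replace 0 0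

end

/-! ### The generating set -/

section

variable {S : Set Move} {m : Move} {x y : List Bool}

namespace Move

/-- The row of strands below both sides of a move. -/
def source : Move → List Bool
  | omega1 _ a => [a]
  | omega2 a b => [a, b]
  | omega3 _ a b => [a, true, b]
  | omega4IIOO _ a b => [true, a, b]
  | omega4Alternating _ a => [true, a, !a]
  | omega5Parallel _ => [true, true]
  | omega5Antiparallel _ a => [a, !a]
  | omega5Alternating _ => [true, false]

/-- The row of strands above both sides of a move. -/
def target : Move → List Bool
  | omega1 _ a => [a]
  | omega2 a b => [a, b]
  | omega3 _ a b => [b, true, a]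
  | omega4IIOO _ a b => [b, a, true]
  | omega4Alternating _ a => [a, !a, true]
  | omega5Parallel _ => [true, true]
  | omega5Antiparallel _ a => [a, !a]
  | omega5Alternating _ => [false, true]

/-- The left side of a move as a tangle. -/
def leftTangle (m : Move) : Tangle m.source m.target where
  word := m.left
  isTangle := by cases m <;> decide +revert

/-- The right side of a move as a tangle. -/
def rightTangle (m : Move) : Tangle m.source m.target where
  word := m.right
  isTangle := by cases m <;> decide +revert

theorem exists_row_of_left (h : IsTangle m.left x y) :
    ∃ q, x = m.source ++ q ∧ y = m.target ++ q := by
  have hnot : ∀ c d : Bool, c = !d → d = !c := by decide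
  rw [isTangle_iff_run] at h
  cases m <;> rcases x with _ | ⟨x₁, _ | ⟨x₂, _ | ⟨x₃, x⟩⟩⟩ <;>
    simp [left, run, Piece.source, Piece.target, source, target] at h ⊢ <;> grind

end Move

theorem TangleEq.of_mem (hm : m ∈ S) : m.leftTangle ≈[S] m.rightTangle :=
  fun p _ u v _ _ _ _ hD hD' => .rel _ _ (.inr ⟨m, hm, p.length, u, v, hD, hD'⟩)

theorem generates_of_tangleEq (h : ∀ m : Move, m.leftTangle ≈[S] m.rightTangle) :
    Generates S := by
  rintro m D D' ⟨n, u, v, hD, hD'⟩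
  obtain ⟨r', hr', hv⟩ := isTangle_append_iff.1 (hD ▸ D.closed)
  obtain ⟨r, hu, hm⟩ := isTangle_append_iff.1 hr'
  have hn : n ≤ r.length := le_length_of_isTangle_shift hm (by cases m <;> simp [Move.left])
  obtain ⟨p, x, y, rfl, rfl, rfl, hxy⟩ := exists_of_isTangle_shift hm hn
  obtain ⟨q, rfl, rfl⟩ := Move.exists_row_of_left hxy
  exact h m p q u v (by simpa using hu) (by simpa using hv) D D' hD hD'

open Move

/-- The ten moves of the theorem. -/
abbrev generators : Set Move := {Ω1a, Ω1b, Ω2a, Ω3a, Ω4a, Ω4e, Ω5a, Ω4j, Ω4l, Ω5g}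

namespace generators

theorem triangle_Ω3a : Triangle generators false true false false false false :=
  .of_mem (m := Ω3a) (by simp)

theorem curl_and_bigon : (∀ o a, Curl generators o a) ∧ ∀ o a b, Bigon generators o a b := by
  have t := triangle_Ω3a
  have c₁ : Curl generators true true := .of_mem (m := Ω1a) (by simp)
  have c₂ : Curl generators true false := .of_mem (m := Ω1b) (by simp)
  have b₁ : Bigon generators true true true := .of_mem (m := Ω2a) (by simp)
  have b₂ : Bigon generators false false false := b₁.half_turn
  have b₃ : Bigon generators true true false := .antiparallel c₁ b₁ t.rotate.rotate
  have b₄ : Bigon generators false false true := .antiparallel c₂ b₂ t.rotate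
  have b₅ : Bigon generators true false true := b₄.half_turn
  have b₆ : Bigon generators false true false := b₃.half_turn
  have c₃ : Curl generators false true := .mirror (o := true) c₂ b₅
  have c₄ : Curl generators false false := .mirror (o := true) c₁ b₃
  have b₇ : Bigon generators false true true := .parallel c₃ b₄ (t.swap b₄ b₃).rotate.rotate
  have b₈ : Bigon generators true false false := b₇.half_turn
  constructor <;> rintro ⟨⟩ ⟨⟩ <;> first | assumption | rintro ⟨⟩ <;> assumption

theorem curl (o a : Bool) : Curl generators o a := curl_and_bigon.1 o a

theorem bigon (o a b : Bool) : Bigon generators o a b := curl_and_bigon.2 o a b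

theorem pass_iioo (o a b : Bool) : Pass generators o true (.iioo a b) := by
  have h : Pass generators o true (.iioo false true) := match o with
    | true => .of_mem (m := Ω4a) (by simp)
    | false => .of_mem (m := Ω4e) (by simp)
  have h₁ : Pass generators o true (.iioo true true) := h.rotate bigon
  have h₂ : Pass generators o true (.iioo true false) := h₁.rotate bigon
  have h₃ : Pass generators o true (.iioo false false) := h₂.rotate bigon
  cases a <;> cases b <;> assumption

theorem pass_alternating (o a : Bool) : Pass generators o true (.alternating a) := by
  have h : Pass generators o true (.alternating false) := match o with
    | true => .of_mem (m := Ω4l) (by simp)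
    | false => .of_mem (m := Ω4j) (by simp)
  match a with
  | false => exact h
  | true => exact h.rotate bigon

theorem trade_iioo_parallel (o : Bool) : Trade generators o (.iioo true true) := by
  have h : Trade generators true (.iioo true true) := .of_mem (m := Ω5a) (by simp)
  match o with
  | true => exact h
  | false => exact h.flip bigon

theorem trade_iioo_antiparallel (o a : Bool) : Trade generators o (.iioo (!a) a) := by
  have h (o : Bool) : Trade generators o (.iioo false true) :=
    Trade.rotate (g := .iioo false false) bigon (curl _ _) (curl _ _) (pass_iioo _ _ _)
      (pass_iioo _ _ _) (trade_iioo_parallel (!o)).half_turn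
  match a with
  | true => exact h o
  | false => simpa [Quad.flip] using (h (!o)).flip bigon

theorem trade_alternating (o : Bool) : Trade generators o (.alternating false) := by
  have h : Trade generators true (.alternating false) := .of_mem (m := Ω5g) (by simp)
  match o with
  | true => exact h
  | false => exact h.half_turn.flip bigon

theorem generates : Generates generators := by
  refine generates_of_tangleEq fun m => ?_
  cases m with
  | omega1 o a => exact curl o a
  | omega2 a b => exact bigon true a b
  | omega3 o a b => exact triangle_Ω3a.monotone bigon o a b
  | omega4IIOO o a b => exact pass_iioo o a b
  | omega4Alternating o a => exact pass_alternating o a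
  | omega5Parallel o => exact trade_iioo_parallel o
  | omega5Antiparallel o a => exact trade_iioo_antiparallel o a
  | omega5Alternating o => exact trade_alternating o

end generators

end

/-! ### Counting colourings -/

section

/-- Rules for colouring the strands of a diagram by `Fin k`: for each crossing and vertex, the list
of the pairs of colours allowed at its upper legs when those of its lower legs are given. -/
structure Colouring (k : ℕ) where
  /-- The difference of the colours of the right and the left leg of a local minimum. -/
  turn : Fin k
  crossing : Bool → Bool → Bool → Fin k → Fin k → List (Fin k × Fin k)
  vertexIIOO : Bool → Bool → Fin k → Fin k → List (Fin k × Fin k)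
  vertexAlternating : Bool → Fin k → Fin k → List (Fin k × Fin k)

/-- The least number of strands below a tangle word. -/
def width : Word → ℕ
  | [] => 0
  | (n, g) :: w => max (n + g.source.length) (width w + g.source.length - g.target.length)

theorem width_le_of_isTangle {w : Word} {s t : List Bool} (h : IsTangle w s t) :
    width w ≤ s.length := by
  induction h with
  | nil => simp [width]
  | cons => simp only [width, List.length_append] at *; lia

theorem width_shift {w : Word} (hw : w ≠ []) (n : ℕ) : width (shift n w) = n + width w := by
  induction w with
  | nil => contradiction
  | cons x w ih =>
    obtain ⟨k, g⟩ := x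
    obtain rfl | hw := eq_or_ne w []
    · simp only [shift_cons, shift_nil, width]; lia
    · simp only [shift_cons, width, ih hw]; lia

namespace Colouring

variable {k n : ℕ} (C : Colouring k) {g : Piece} {p q l m : List (Fin k)} {w L R : Word}

/-- The rows of colours allowed above a piece, the colours below it being given. -/
def rel : Piece → List (Fin k) → List (List (Fin k))
  | .cup _, _ => (List.finRange k).map fun y => [y, y + C.turn]
  | .cap _, [x, y] => if x = y + C.turn then [[]] else []
  | .crossing o a b, [x, y] => (C.crossing o a b x y).map fun z => [z.1, z.2]
  | .vertexIIOO a b, [x, y] => (C.vertexIIOO a b x y).map fun z => [z.1, z.2]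
  | .vertexAlternating a, [x, y] => (C.vertexAlternating a x y).map fun z => [z.1, z.2]
  | _, _ => []

theorem length_of_mem_rel (h : m ∈ C.rel g l) : m.length = g.target.length := by
  unfold rel at h
  split at h <;> grind [Piece.target]

/-- The rows of colours above a tangle word in its colourings with a given row of colours below it,
with multiplicities. -/
def extend : Word → List (Fin k) → Multiset (List (Fin k))
  | [], l => {l}
  | (n, g) :: w, l => (C.rel g ((l.drop n).take g.source.length) : Multiset _).bind fun m =>
      extend w (l.take n ++ m ++ l.drop (n + g.source.length))

theorem extend_cons (hn : p.length = n) (hl : l.length = g.source.length) :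
    C.extend ((n, g) :: w) (p ++ l ++ q) =
      (C.rel g l : Multiset _).bind fun m => C.extend w (p ++ m ++ q) := by
  subst hn
  rw [extend, ← hl]
  simp

theorem extend_append (u v : Word) (l : List (Fin k)) :
    C.extend (u ++ v) l = (C.extend u l).bind (C.extend v) := by
  induction u generalizing l with
  | nil => simp [extend]
  | cons x u ih => simp only [List.cons_append, extend, ih, Multiset.bind_assoc]

theorem exists_of_le_length (h : n + g.source.length ≤ l.length) :
    ∃ p m q : List (Fin k), p.length = n ∧ m.length = g.source.length ∧ l = p ++ m ++ q :=
  ⟨l.take n, (l.drop n).take g.source.length, (l.drop n).drop g.source.length,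
    by simp only [List.length_take]; lia, by simp only [List.length_take, List.length_drop]; lia,
    by simp⟩

theorem extend_whisker (hl : width w ≤ l.length) (p q : List (Fin k)) :
    C.extend (shift p.length w) (p ++ l ++ q) = (C.extend w l).map (p ++ · ++ q) := by
  induction w generalizing l with
  | nil => simp [extend]
  | cons x w ih =>
    obtain ⟨n, g⟩ := x
    simp only [width, sup_le_iff] at hl
    obtain ⟨a, b, c, rfl, hb, rfl⟩ := exists_of_le_length hl.1
    calc
      _ = (C.rel g b : Multiset _).bind fun m =>
          C.extend (shift p.length w) (p ++ (a ++ m ++ c) ++ q) := by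
        simpa using C.extend_cons (p := p ++ a) (q := c ++ q) (w := shift p.length w) rfl hb
      _ = (C.rel g b : Multiset _).bind fun m => (C.extend w (a ++ m ++ c)).map (p ++ · ++ q) := by
        refine Multiset.bind_congr fun m hm => ih ?_
        have := C.length_of_mem_rel (Multiset.mem_coe.1 hm)
        simp only [List.length_append] at hl ⊢
        lia
      _ = _ := by rw [C.extend_cons rfl hb, Multiset.map_bind]

theorem length_of_mem_extend {s t : List Bool} (h : IsTangle w s t) (hl : l.length = s.length)
    (hm : m ∈ C.extend w l) : m.length = t.length := by
  induction h generalizing l with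
  | nil => simp_all [extend]
  | cons g w p q t _ ih =>
    obtain ⟨y, hy, hm⟩ := Multiset.mem_bind.1 hm
    refine ih ?_ hm
    have := C.length_of_mem_rel (Multiset.mem_coe.1 hy)
    simp only [List.length_append, List.length_take, List.length_drop] at hl ⊢
    lia

/-- Replacing a tangle word by another one does not change the colourings around it. The widths
ensure that this need be checked only for rows of `width L` colours. -/
def Preserves (L R : Word) : Prop :=
  width R ≤ width L ∧ ∀ l, width L ≤ l.length → C.extend L l = C.extend R l

theorem preserves_iff : C.Preserves L R ↔ width R ≤ width L ∧
    ∀ f : Fin (width L) → Fin k, C.extend L (List.ofFn f) = C.extend R (List.ofFn f) := by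
  refine and_congr_right fun hw => ⟨fun h f => h _ (by simp), fun h l hl => ?_⟩
  obtain ⟨a, b, ha, rfl⟩ : ∃ a b, a.length = width L ∧ l = a ++ b :=
    ⟨l.take (width L), l.drop (width L), by simpa, by simp⟩
  obtain ⟨f, rfl⟩ : ∃ f : Fin (width L) → Fin k, a = List.ofFn f :=
    ⟨_, (List.ofFn_get a).symm.trans (List.ofFn_congr ha _)⟩
  have hL := C.extend_whisker (w := L) (l := List.ofFn f) (by simp) [] b
  have hR := C.extend_whisker (w := R) (l := List.ofFn f) (by simpa) [] b
  simp only [List.length_nil, shift_zero, List.nil_append] at hL hR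
  rw [hL, hR, h]

instance : Decidable (C.Preserves L R) := decidable_of_iff _ C.preserves_iff.symm

variable {C}

theorem preserves_exchange (g h : Piece) (n : ℕ) :
    C.Preserves [(0, g), (g.target.length + n, h)] [(g.source.length + n, h), (0, g)] := by
  refine ⟨by simp only [width]; lia, fun l hl => ?_⟩
  have hl : (g.source.length + n) + h.source.length ≤ l.length := by
    simp only [width] at hl
    lia
  obtain ⟨p, b, c, hp, hb, rfl⟩ := exists_of_le_length hl
  obtain ⟨p', a, m, hp', ha, rfl⟩ := exists_of_le_length (n := 0) (g := g) (l := p) (by lia)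
  obtain rfl := List.length_eq_zero_iff.1 hp'
  rw [C.extend_cons hp hb]
  simp only [List.append_assoc]
  have first (w : Word) (y : List (Fin k)) : C.extend ((0, g) :: w) ([] ++ (a ++ y)) =
      (C.rel g a : Multiset _).bind fun x => C.extend w (x ++ y) := by
    simpa using C.extend_cons (p := []) (q := y) (w := w) rfl ha
  simp only [first]
  rw [Multiset.bind_bind]
  refine Multiset.bind_congr fun x hx => ?_
  have hx := C.length_of_mem_rel (Multiset.mem_coe.1 hx)
  have := C.extend_cons (w := []) (n := g.target.length + n) (p := x ++ m) (q := c)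
    (by simp only [List.length_append] at hp ⊢; lia) hb
  simpa using this

/-- The number of colourings of a diagram. -/
def count (C : Colouring k) (D : Diagram) : ℕ := (C.extend D.word []).card

theorem Preserves.count_eq (h : C.Preserves L R) (hL : L ≠ []) {D D' : Diagram}
    (hD : Replaces L R D D') : C.count D = C.count D' := by
  obtain ⟨n, u, v, e, e'⟩ := hD
  obtain ⟨r', hr', -⟩ := isTangle_append_iff.1 (e ▸ D.closed)
  obtain ⟨r, hu, hr⟩ := isTangle_append_iff.1 hr'
  rw [count, count, e, e', extend_append, extend_append, extend_append, extend_append]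
  congr 2
  refine Multiset.bind_congr fun l hl => ?_
  have hlr := C.length_of_mem_extend hu rfl hl
  have hw := width_le_of_isTangle hr
  rw [width_shift hL] at hw
  obtain ⟨p, y, rfl, rfl⟩ : ∃ p y, p.length = n ∧ l = p ++ y :=
    ⟨l.take n, l.drop n, by simp only [List.length_take]; lia, by simp⟩
  have hy : width L ≤ y.length := by simp only [List.length_append] at hlr; lia
  have key (w : Word) (hw : width w ≤ y.length) := C.extend_whisker hw p []
  simp only [List.append_nil] at key
  rw [key L hy, key R (h.1.trans hy), h.2 y hy]

variable (C)

/-- The colourings are invariant under planar isotopies. -/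
abbrev Planar : Prop :=
  (∀ a, C.Preserves [(0, .cup a), (1, .cap (!a))] []) ∧
  (∀ a, C.Preserves [(1, .cup a), (0, .cap (!a))] []) ∧
  (∀ o a b, C.Preserves [(0, .crossing o a b), (1, .cap a)]
    [(1, .crossing (!o) b (!a)), (0, .cap a)]) ∧
  (∀ a b, C.Preserves [(0, .vertexIIOO a b), (1, .cap a)] [(1, .vertexIIOO b (!a)), (0, .cap a)]) ∧
  ∀ a, C.Preserves [(0, .vertexAlternating a), (1, .cap (!a))]
    [(1, .vertexAlternating (!a)), (0, .cap a)]

variable {C}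

theorem Planar.preserves (hC : C.Planar) (h : PlanarRule L R) : C.Preserves L R := by
  obtain ⟨h₁, h₂, h₃, h₄, h₅⟩ := hC
  cases h with
  | exchange g h m => exact preserves_exchange g h m
  | zigzagLeft a => exact h₁ a
  | zigzagRight a => exact h₂ a
  | turnCrossing o a b => exact h₃ o a b
  | turnIIOO a b => exact h₄ a b
  | turnAlternating a => exact h₅ a

theorem count_eq_of_joined {S : Set Move} (hC : C.Planar)
    (hS : ∀ m ∈ S, C.Preserves m.left m.right) {D D' : Diagram} (h : Joined S D D') :
    C.count D = C.count D' := by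
  induction h with
  | rel D D' h =>
    obtain ⟨L, R, h, hD⟩ | ⟨m, hm, hD⟩ := h
    · exact (hC.preserves h).count_eq (by cases h <;> simp) hD
    · exact (hS m hm).count_eq (by cases m <;> simp [Move.left]) hD
  | refl => rfl
  | symm _ _ _ ih => exact ih.symm
  | trans _ _ _ _ _ ih₁ ih₂ => exact ih₁.trans ih₂

end Colouring

end

/-! ### Colourings that detect the moves -/

deriving instance DecidableEq for Move

namespace Colouring

open Piece Move

variable {k : ℕ}

theorem mem_of_generates {T : Set Move} (hT : T ⊆ generators) (h : Generates T) (m : Move)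
    (C : Colouring k) (u v : Word) (hC : C.Planar := by decide +kernel)
    (hS : ∀ m' ∈ generators, m' ≠ m → C.Preserves m'.left m'.right := by
      rintro _ (rfl | rfl | rfl | rfl | rfl | rfl | rfl | rfl | rfl | rfl) <;> decide +kernel)
    (hL : IsTangle (u ++ m.left ++ v) [] [] := by decide +kernel)
    (hR : IsTangle (u ++ m.right ++ v) [] [] := by decide +kernel)
    (hne : C.count ⟨_, hL⟩ ≠ C.count ⟨_, hR⟩ := by decide +kernel) : m ∈ T := by
  by_contra hm
  refine hne (count_eq_of_joined hC (fun m' hm' => hS m' (hT hm') fun e => hm (e ▸ hm')) ?_)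
  exact h m _ _ ⟨0, u, v, by simp, by simp⟩

/-- Colourings of links by `Fin 3`: followed in its direction, a strand loses the sign of the
crossing at each of its overcrossings and `s` at each clockwise half-turn. Since `-2 = 1` in
`Fin 3`, a positive curl changes the colour by `-1 + s` if it runs clockwise and by `-1 - s`
otherwise. -/
def writheRotation (s : Fin 3) : Colouring 3 where
  turn := s
  crossing o a b x y :=
    let ε := o == (a == b)
    if o then [(y, if ε == a then x - 1 else x + 1)] else [(if ε == b then y - 1 else y + 1, x)]
  vertexIIOO _ _ _ _ := []
  vertexAlternating _ _ _ := []

/-- Colourings of links in which a crossing joins both strands, so that there is a colour for each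
connected component of the underlying plane curve. -/
def parts : Colouring 2 where
  turn := 0
  crossing _ _ _ x y := if x = y then [(x, x)] else []
  vertexIIOO _ _ _ _ := []
  vertexAlternating _ _ _ := []

/-- Colourings of links by an operation that is idempotent and involutive, as `Ω1` and `Ω2` need,
but not self-distributive, as `Ω3` needs. -/
def nondistributive : Colouring 3 where
  turn := 0
  crossing o _ _ x y := if o then [(op y x, x)] else [(y, op x y)]
  vertexIIOO _ _ _ _ := []
  vertexAlternating _ _ _ := []
where
  /-- Exchange `1`, `2` under `0`, exchange `0`, `2` under `1`, and fix all under `2`. -/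
  op (x y : Fin 3) : Fin 3 := if y = 0 then -x else if y = 1 then 2 - x else x

/-- Fox colourings of the diagram (of its mirror image if `m = false`) in which the legs of the
vertices have the colour `0`: a strand may pass under such a vertex but not over it. Vertices of the
types not selected by `iioo` and `alternating` have no colourings. -/
def fox (m iioo alternating : Bool) : Colouring 3 where
  turn := 0
  crossing o _ _ x y := if o = m then [(-x - y, x)] else [(y, -x - y)]
  vertexIIOO _ _ x y := if iioo = true ∧ x = 0 ∧ y = 0 then [(0, 0)] else []
  vertexAlternating _ x y := if alternating = true ∧ x = 0 ∧ y = 0 then [(0, 0)] else []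

/-- Colourings that ignore the crossings; at an In-In-Out-Out vertex the left incoming and the left
outgoing edge, seen along the flow, have the colour `0` and the right ones have the colour `1`. -/
def prescribed : Colouring 2 where
  turn := 0
  crossing _ _ _ x y := [(y, x)]
  vertexIIOO a b x y :=
    if x = (if b then 0 else 1) ∧ y = (if a then 1 else 0) then
      [(if a then 0 else 1, if b then 1 else 0)] else []
  vertexAlternating _ _ _ := []

/-- Colourings of the circles that arise when each In-Out-In-Out vertex is smoothed by joining each
incoming edge to the next outgoing edge clockwise; flipping the vertex over changes the smoothing,
and crossings are ignored. -/
def smoothing : Colouring 2 where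
  turn := 0
  crossing _ _ _ x y := [(y, x)]
  vertexIIOO _ _ _ _ := []
  vertexAlternating a x y := if a then [(x, y)] else if x = y then [(0, 0), (1, 1)] else []

end Colouring

open Piece Move Colouring

theorem generators_subset_of_generates {T : Set Move} (hT : T ⊆ generators) (h : Generates T) :
    generators ⊆ T := by
  rintro m (rfl | rfl | rfl | rfl | rfl | rfl | rfl | rfl | rfl | rfl)
  · exact mem_of_generates hT h Ω1a (.writheRotation 2) [(0, cup true)] [(0, cap true)]
  · exact mem_of_generates hT h Ω1b (.writheRotation 1) [(0, cup false)] [(0, cap false)]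
  · exact mem_of_generates hT h Ω2a .parts [(0, cup true), (1, cup true)]
      [(1, cap true), (0, cap true)]
  · exact mem_of_generates hT h Ω3a .nondistributive [(0, cup false), (1, cup true), (2, cup false)]
      [(0, crossing false false true), (0, crossing false true false), (2, cap false),
        (1, cap true), (0, cap false)]
  · exact mem_of_generates hT h Ω4a (.fox true true false)
      [(0, cup true), (1, cup true), (2, cup false), (1, vertexIIOO true false)]
      [(1, crossing false false true), (0, crossing false true true), (2, cap false), (1, cap true),
        (0, cap true)]
  · exact mem_of_generates hT h Ω4e (.fox false true false)
      [(0, cup true), (1, cup true), (2, cup false), (1, vertexIIOO true false)]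
      [(1, crossing true false true), (0, crossing true true true), (2, cap false), (1, cap true),
        (0, cap true)]
  · exact mem_of_generates hT h Ω5a .prescribed
      [(0, cup true), (1, cup true), (0, vertexIIOO true true)]
      [(0, crossing true true true), (1, cap true), (0, cap true)]
  · exact mem_of_generates hT h Ω4j (.fox false false true)
      [(0, cup true), (1, cup false), (2, cup true), (1, vertexAlternating false)]
      [(1, crossing true true true), (0, crossing true false true), (2, cap true), (1, cap false),
        (0, cap true)]
  · exact mem_of_generates hT h Ω4l (.fox true false true)
      [(0, cup true), (1, cup false), (2, cup true), (1, vertexAlternating false)]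
      [(1, crossing false true true), (0, crossing false false true), (2, cap true), (1, cap false),
        (0, cap true)]
  · exact mem_of_generates hT h Ω5g .smoothing [(0, cup true)] [(0, cap false)]

end KnottedGraph

open KnottedGraph KnottedGraph.Move in
theorem theorem3p5 :
    Minimal Generates ({Ω1a, Ω1b, Ω2a, Ω3a, Ω4a, Ω4e, Ω5a, Ω4j, Ω4l, Ω5g} : Set Move) :=
  ⟨generators.generates, fun _ hT hle => generators_subset_of_generates hle hT⟩
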